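/- An arrangement of segments is a finite set of compact straight-line segments in the plane in general position, i.e., the endpoints of the segments are distinct points and no three of them are collinear. For a positive integer $k$, let $r(k)$ be the largest number of segments in an arrangement with at most $k$ pairwise crossing and at most $k$ pairwise disjoint segments, where two segments cross if they intersect. Theorem 1. For infinitely many positive integers $k$ there exists an arrangement of exactly $k^{\log 169/\log 8} > k^{2.4669}$ segments with at most $k$ pairwise crossing and at most $k$ pairwise disjoint segments. Consequently, $r(k) \ge k^{\log 169/\log 8}$ for infinitely many positive integers $k$. -/

import Mathlib

open scoped ENNReal

/-- The Euclidean plane. -/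
abbrev Plane : Type := EuclideanSpace ℝ (Fin 2)

/-- An arrangement of `n` compact straight-line segments in the plane in general position: the
`i`-th segment has the endpoints `endpoint (i, false)` and `endpoint (i, true)`, the `2 * n`
endpoints are distinct points, and no three of them are collinear. -/
structure SegmentArrangement (n : ℕ) where
  /-- The two endpoints of each segment. -/
  endpoint : Fin n × Bool → Plane
  /-- The endpoints are distinct points. -/
  endpoint_injective : Function.Injective endpoint
  /-- No three endpoints are collinear. -/
  not_collinear : ∀ a b c : Fin n × Bool, a ≠ b → a ≠ c → b ≠ c →
    ¬ Collinear ℝ {endpoint a, endpoint b, endpoint c}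

namespace SegmentArrangement

variable {n : ℕ}

/-- The `i`-th segment of the arrangement, as a set of points of the plane. -/
def seg (M : SegmentArrangement n) (i : Fin n) : Set Plane :=
  segment ℝ (M.endpoint (i, false)) (M.endpoint (i, true))

/-- Two segments cross if they have a common point. (By general position, a common point of two
different segments is then an interior point of both.) -/
def Crosses (M : SegmentArrangement n) (i j : Fin n) : Prop :=
  (M.seg i ∩ M.seg j).Nonempty

/-- A `(k, l)`-arrangement: at most `k` pairwise crossing segments and at most `l` pairwise
disjoint segments. -/
def IsKL (M : SegmentArrangement n) (k l : ℕ) : Prop :=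
  (∀ S : Finset (Fin n), (S : Set (Fin n)).Pairwise (fun i j => M.Crosses i j) → S.card ≤ k) ∧
  (∀ S : Finset (Fin n),
    (S : Set (Fin n)).Pairwise (fun i j => Disjoint (M.seg i) (M.seg j)) → S.card ≤ l)

end SegmentArrangement

/-- `ramseySegments k` is the largest number `r(k)` such that there is an arrangement of `r(k)`
segments with at most `k` pairwise crossing and at most `k` pairwise disjoint segments. It is
a supremum in `ℕ∞`, so that there is no default value: a finite supremum is a maximum. -/
noncomputable def ramseySegments (k : ℕ) : ℕ∞ :=
  sSup {m : ℕ∞ | ∃ n : ℕ, m = n ∧ ∃ M : SegmentArrangement n, M.IsKL k k}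

/-! Arrangements can be substituted into one another. If every segment of an arrangement with
crossing graph `G` is replaced by a very thin copy of an arrangement with crossing graph `H`, the
crossing graph becomes the lexicographic product, whose clique and independence bounds are the
products of the old ones. This needs `H` to be realizable arbitrarily close to a single segment;
`Flattenable.lexProduct` shows that this property survives substitution, so it can be iterated.

The seed is a circulant graph on 13 vertices with clique bound 2 and independence bound 4. Both it
and its complement are flattenable (`flattenable_circulant`, `flattenable_not_circulant`), so their
product has 169 vertices and both bounds equal to 8. Its powers give `169 ^ m` segments for `k = 8 ^
m`. Flattenability of the seeds reduces to signs of integer polynomials near `0`, a finite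
computation. -/

open Filter Topology

/-! ### Crossing and disjointness through orientations -/

/-- The signed area (times two) of the triangle `a b c`. -/
def orient (a b c : ℝ × ℝ) : ℝ := (b.1 - a.1) * (c.2 - a.2) - (b.2 - a.2) * (c.1 - a.1)

/-- The endpoints of each of the two segments lie strictly on different sides of the line through
the other one. -/
def StrictlyCross (p q : (ℝ × ℝ) × (ℝ × ℝ)) : Prop :=
  orient p.1 p.2 q.1 * orient p.1 p.2 q.2 < 0 ∧ orient q.1 q.2 p.1 * orient q.1 q.2 p.2 < 0

/-- The endpoints of one of the two segments lie strictly on the same side of the line through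
the other one. -/
def StrictlySeparated (p q : (ℝ × ℝ) × (ℝ × ℝ)) : Prop :=
  0 < orient p.1 p.2 q.1 * orient p.1 p.2 q.2 ∨ 0 < orient q.1 q.2 p.1 * orient q.1 q.2 p.2

/-- The pair of segments `p`, `q` crosses or is disjoint, stably under small perturbations,
as prescribed by `adj`. -/
def Realizes (adj : Prop) (p q : (ℝ × ℝ) × (ℝ × ℝ)) : Prop :=
  (adj → StrictlyCross p q) ∧ (¬ adj → StrictlySeparated p q)

@[fun_prop]
lemma Continuous.orient {X : Type*} [TopologicalSpace X] {f g h : X → ℝ × ℝ} (hf : Continuous f)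
    (hg : Continuous g) (hh : Continuous h) : Continuous fun x => orient (f x) (g x) (h x) := by
  unfold _root_.orient
  fun_prop

lemma isOpen_realizes (adj : Prop) :
    IsOpen {x : ((ℝ × ℝ) × (ℝ × ℝ)) × ((ℝ × ℝ) × (ℝ × ℝ)) | Realizes adj x.1 x.2} := by
  by_cases h : adj
  · simp only [Realizes, h, not_true_eq_false, forall_const, false_implies, and_true,
      StrictlyCross]
    refine IsOpen.and (isOpen_lt ?_ ?_) (isOpen_lt ?_ ?_) <;> fun_prop
  · simp only [Realizes, h, not_false_eq_true, forall_const, false_implies, true_and,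
      StrictlySeparated]
    rw [Set.ofPred_or]
    refine (isOpen_lt ?_ ?_).union (isOpen_lt ?_ ?_) <;> fun_prop

/-- The point of the Euclidean plane with given coordinates. -/
def toPlane (p : ℝ × ℝ) : Plane := !₂[p.1, p.2]

lemma StrictlyCross.segment_inter_nonempty {p q : (ℝ × ℝ) × (ℝ × ℝ)} (h : StrictlyCross p q) :
    (segment ℝ (toPlane p.1) (toPlane p.2) ∩ segment ℝ (toPlane q.1) (toPlane q.2)).Nonempty := by
  obtain ⟨⟨a1, a2⟩, ⟨b1, b2⟩⟩ := p
  obtain ⟨⟨c1, c2⟩, ⟨d1, d2⟩⟩ := q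
  obtain ⟨h1, h2⟩ := h
  set s := orient (a1, a2) (b1, b2) (c1, c2) with hs
  set s' := orient (a1, a2) (b1, b2) (d1, d2) with hs'
  set t := orient (c1, c2) (d1, d2) (a1, a2) with ht
  set t' := orient (c1, c2) (d1, d2) (b1, b2) with ht'
  have weights : ∀ x y : ℝ, x * y < 0 → x - y ≠ 0 ∧ 0 ≤ x / (x - y) ∧ 0 ≤ -y / (x - y) := by
    intro x y hxy
    rcases mul_neg_iff.1 hxy with ⟨hx, hy⟩ | ⟨hx, hy⟩
    · exact ⟨by linarith, div_nonneg hx.le (by linarith), div_nonneg (by linarith) (by linarith)⟩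
    · exact ⟨by linarith, div_nonneg_of_nonpos hx.le (by linarith),
        div_nonneg_of_nonpos (by linarith) (by linarith)⟩
  obtain ⟨hs0, hs1, hs2⟩ := weights s s' h1
  obtain ⟨ht0, ht1, ht2⟩ := weights t t' h2
  -- Both differences are, up to sign, the cross product of the two direction vectors, so the two
  -- convex combinations have a common denominator.
  have hst : t - t' = -(s - s') := by simp only [hs, hs', ht, ht', orient]; ring
  refine ⟨(-t' / (t - t')) • toPlane (a1, a2) + (t / (t - t')) • toPlane (b1, b2),
    ⟨_, _, ht2, ht1, by field_simp; ring, rfl⟩,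
    ⟨_, _, hs2, hs1, by field_simp; ring, ?_⟩⟩
  have h1 : -s' * c1 + s * d1 = t' * a1 - t * b1 := by
    simp only [hs, hs', ht, ht', orient]; ring
  have h2 : -s' * c2 + s * d2 = t' * a2 - t * b2 := by
    simp only [hs, hs', ht, ht', orient]; ring
  rw [hst]
  clear_value s s' t t'
  have hi : (s' - s)⁻¹ = -(s - s')⁻¹ := by rw [← neg_sub, inv_neg]
  ext i
  fin_cases i
  · simp [toPlane]
    linear_combination (s - s')⁻¹ * h1 + (t' * a1 - t * b1) * hi
  · simp [toPlane]
    linear_combination (s - s')⁻¹ * h2 + (t' * a2 - t * b2) * hi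

lemma orient_eq_zero_of_segment {a b z : ℝ × ℝ} {u v : ℝ} (huv : u + v = 1)
    (h1 : z.1 = u * a.1 + v * b.1) (h2 : z.2 = u * a.2 + v * b.2) : orient a b z = 0 := by
  obtain rfl : u = 1 - v := by linarith
  rw [orient, h1, h2]; ring

lemma orient_segment (a b : ℝ × ℝ) {c d z : ℝ × ℝ} {u v : ℝ} (huv : u + v = 1)
    (h1 : z.1 = u * c.1 + v * d.1) (h2 : z.2 = u * c.2 + v * d.2) :
    orient a b z = u * orient a b c + v * orient a b d := by
  obtain rfl : u = 1 - v := by linarith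
  rw [orient, h1, h2, orient, orient]; ring

/-- `orient a b` is affine in its third argument and vanishes on the line through `a` and `b`, so a
convex combination of values of one strict sign cannot reach that line. -/
lemma disjoint_segment_of_same_side {a b c d : ℝ × ℝ}
    (h : 0 < orient a b c * orient a b d) :
    Disjoint (segment ℝ (toPlane a) (toPlane b)) (segment ℝ (toPlane c) (toPlane d)) := by
  rw [Set.disjoint_left]
  rintro z ⟨u, v, -, -, huv, hz⟩ ⟨u', v', hu', hv', huv', hz'⟩
  have e0 := congrArg (fun z : Plane => z 0) hz
  have e1 := congrArg (fun z : Plane => z 1) hz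
  have e0' := congrArg (fun z : Plane => z 0) hz'
  have e1' := congrArg (fun z : Plane => z 1) hz'
  simp [toPlane] at e0 e1 e0' e1'
  have k := orient_eq_zero_of_segment (z := (z 0, z 1)) (a := a) (b := b) huv e0.symm e1.symm
  rw [orient_segment a b (z := (z 0, z 1)) (c := c) (d := d) huv' e0'.symm e1'.symm] at k
  rcases mul_pos_iff.1 h with ⟨hc, hd⟩ | ⟨hc, hd⟩
  · nlinarith [mul_nonneg hu' hc.le, mul_nonneg hv' hd.le]
  · nlinarith [mul_nonneg hu' (neg_nonneg.2 hc.le), mul_nonneg hv' (neg_nonneg.2 hd.le)]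

lemma StrictlySeparated.disjoint_segment {p q : (ℝ × ℝ) × (ℝ × ℝ)} (h : StrictlySeparated p q) :
    Disjoint (segment ℝ (toPlane p.1) (toPlane p.2)) (segment ℝ (toPlane q.1) (toPlane q.2)) :=
  h.elim disjoint_segment_of_same_side fun h => (disjoint_segment_of_same_side h).symm

lemma orient_eq_zero_of_collinear {a b c : ℝ × ℝ}
    (h : Collinear ℝ {toPlane a, toPlane b, toPlane c}) : orient a b c = 0 := by
  obtain ⟨v, hv⟩ := (collinear_iff_of_mem (p₀ := toPlane a) (by simp)).1 h
  obtain ⟨r, hr⟩ := hv (toPlane b) (by simp)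
  obtain ⟨s, hs⟩ := hv (toPlane c) (by simp)
  have r0 := congrArg (fun z : Plane => z 0) hr
  have r1 := congrArg (fun z : Plane => z 1) hr
  have s0 := congrArg (fun z : Plane => z 0) hs
  have s1 := congrArg (fun z : Plane => z 1) hs
  simp [toPlane] at r0 r1 s0 s1
  rw [orient, r0, r1, s0, s1]; ring

/-! ### Perturbation into general position -/

lemma eventually_quadratic_ne_zero {A B C : ℝ} (h : B ≠ 0 ∨ C ≠ 0) :
    ∀ᶠ t in 𝓝[>] (0 : ℝ), A + B * t + C * t ^ 2 ≠ 0 := by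
  by_cases hA : A = 0
  · by_cases hB : B = 0
    · filter_upwards [self_mem_nhdsWithin] with t ht
      have ht : t ≠ 0 := ne_of_gt ht
      simp [hA, hB, ht, h.resolve_left (not_not.2 hB)]
    · have : ∀ᶠ t in 𝓝[>] (0 : ℝ), B + C * t ≠ 0 :=
        (ContinuousAt.eventually_ne (by fun_prop) (by simpa)).filter_mono nhdsWithin_le_nhds
      filter_upwards [this, self_mem_nhdsWithin] with t h1 ht
      have ht : t ≠ 0 := ne_of_gt ht
      rw [show A + B * t + C * t ^ 2 = t * (B + C * t) by rw [hA]; ring]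
      exact mul_ne_zero ht h1
  · exact (ContinuousAt.eventually_ne (by fun_prop) (by simpa)).filter_mono nhdsWithin_le_nhds

/-- Finitely many points can be moved into general position by arbitrarily small shifts along a
parabola. -/
def parabolicShift (t s : ℝ) (p : ℝ × ℝ) : ℝ × ℝ := (p.1 + t * s, p.2 + t * s ^ 2)

lemma eventually_parabolicShift_ne (p q : ℝ × ℝ) {r s : ℝ} (h : r ≠ s) :
    ∀ᶠ t in 𝓝[>] (0 : ℝ), parabolicShift t r p ≠ parabolicShift t s q := by
  filter_upwards [eventually_quadratic_ne_zero (A := p.1 - q.1) (B := r - s) (C := 0)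
    (Or.inl (sub_ne_zero.2 h))] with t ht heq
  have := congrArg Prod.fst heq
  simp only [parabolicShift] at this
  exact ht (by linear_combination this)

/-- The coefficient of `t ^ 2` is the orientation of three distinct points of the parabola, a
Vandermonde determinant, whatever `p`, `q`, `r` are. -/
lemma eventually_orient_parabolicShift_ne_zero (p q r : ℝ × ℝ) {a b c : ℝ} (hab : a ≠ b)
    (hac : a ≠ c) (hbc : b ≠ c) : ∀ᶠ t in 𝓝[>] (0 : ℝ),
      orient (parabolicShift t a p) (parabolicShift t b q) (parabolicShift t c r) ≠ 0 := by
  filter_upwards [eventually_quadratic_ne_zero (A := orient p q r)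
    (B := (b - a) * (r.2 - p.2) + (q.1 - p.1) * (c ^ 2 - a ^ 2)
      - (b ^ 2 - a ^ 2) * (r.1 - p.1) - (q.2 - p.2) * (c - a))
    (C := (b - a) * (c - a) * (c - b))
    (Or.inr (mul_ne_zero (mul_ne_zero (sub_ne_zero.2 hab.symm) (sub_ne_zero.2 hac.symm))
      (sub_ne_zero.2 hbc.symm)))] with t ht heq
  refine ht (Eq.trans ?_ heq)
  simp only [orient, parabolicShift]; ring

/-- Every stable family of segments has the same crossing pattern as some arrangement. -/
lemma exists_segmentArrangement {n : ℕ} (G : Fin n → Fin n → Prop)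
    (e : Fin n → (ℝ × ℝ) × (ℝ × ℝ)) (he : ∀ i j, i ≠ j → Realizes (G i j) (e i) (e j)) :
    ∃ M : SegmentArrangement n, ∀ i j, i ≠ j →
      (G i j → M.Crosses i j) ∧ (¬ G i j → Disjoint (M.seg i) (M.seg j)) := by
  obtain ⟨key, hkey⟩ : ∃ key : Fin n × Bool → ℝ, Function.Injective key :=
    ⟨fun x => (Fintype.equivFin _ x : ℕ), fun x y h => by
      simpa [Fin.val_inj] using h⟩
  let pt : ℝ → Fin n × Bool → ℝ × ℝ := fun t x =>
    parabolicShift t (key x) (if x.2 then (e x.1).2 else (e x.1).1)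
  have h1 : ∀ᶠ t in 𝓝[>] (0 : ℝ), ∀ i j, i ≠ j →
      Realizes (G i j) (pt t (i, false), pt t (i, true)) (pt t (j, false), pt t (j, true)) := by
    simp only [eventually_all]
    intro i j hij
    refine Filter.Eventually.filter_mono nhdsWithin_le_nhds ?_
    have hc : Continuous fun t => (((pt t (i, false), pt t (i, true)),
        (pt t (j, false), pt t (j, true))) : ((ℝ × ℝ) × (ℝ × ℝ)) × ((ℝ × ℝ) × (ℝ × ℝ))) := by
      simp only [pt, parabolicShift]; fun_prop
    refine hc.continuousAt.eventually ((isOpen_realizes (G i j)).mem_nhds ?_)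
    simpa [pt, parabolicShift] using he i j hij
  have h2 : ∀ᶠ t in 𝓝[>] (0 : ℝ), ∀ a b, a ≠ b → pt t a ≠ pt t b := by
    simp only [eventually_all]
    exact fun a b hab => eventually_parabolicShift_ne _ _ (hkey.ne hab)
  have h3 : ∀ᶠ t in 𝓝[>] (0 : ℝ), ∀ a b c, a ≠ b → a ≠ c → b ≠ c →
      orient (pt t a) (pt t b) (pt t c) ≠ 0 := by
    simp only [eventually_all]
    exact fun a b c hab hac hbc => eventually_orient_parabolicShift_ne_zero _ _ _
      (hkey.ne hab) (hkey.ne hac) (hkey.ne hbc)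
  obtain ⟨t, h1, h2, h3⟩ := (h1.and (h2.and h3)).exists
  refine ⟨⟨fun x => toPlane (pt t x), fun a b hab => ?_, fun a b c hab hac hbc hcol =>
    h3 a b c hab hac hbc (orient_eq_zero_of_collinear hcol)⟩, fun i j hij =>
    ⟨fun h => ((h1 i j hij).1 h).segment_inter_nonempty,
     fun h => ((h1 i j hij).2 h).disjoint_segment⟩⟩
  by_contra hne
  refine h2 a b hne (Prod.ext ?_ ?_)
  · simpa [toPlane] using congrArg (fun z : Plane => z 0) hab
  · simpa [toPlane] using congrArg (fun z : Plane => z 1) hab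

/-! ### Flattenable graphs and lexicographic products -/

/-- The segment joining `(0, 0)` and `(1, 0)`. -/
def unitSegment : (ℝ × ℝ) × (ℝ × ℝ) := ((0, 0), (1, 0))

/-- A graph is flattenable if it is the crossing graph of a stable family of segments that are
arbitrarily close to the unit segment. -/
def Flattenable {V : Type*} (G : V → V → Prop) : Prop :=
  ∀ s ∈ 𝓝 unitSegment, ∃ e : V → (ℝ × ℝ) × (ℝ × ℝ),
    (∀ v, e v ∈ s) ∧ ∀ u v, u ≠ v → Realizes (G u v) (e u) (e v)

/-- Every set of pairwise `G`-related elements has at most `k` elements. -/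
def CliqueBound {V : Type*} (G : V → V → Prop) (k : ℕ) : Prop :=
  ∀ S : Finset V, (S : Set V).Pairwise G → S.card ≤ k

/-- The lexicographic product: each vertex of `G` is replaced by a copy of `H`. -/
def lexProduct {V W : Type*} [DecidableEq V] (G : V → V → Prop) (H : W → W → Prop)
    (x y : V × W) : Prop :=
  if x.1 = y.1 then H x.2 y.2 else G x.1 y.1

/-- Lets the bound for independent sets follow from the one for cliques, applied to complements. -/
lemma not_lexProduct {V W : Type*} [DecidableEq V] (G : V → V → Prop) (H : W → W → Prop)
    (x y : V × W) :
    ¬ lexProduct G H x y ↔ lexProduct (fun u v => ¬ G u v) (fun u v => ¬ H u v) x y := by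
  unfold lexProduct
  split <;> rfl

lemma CliqueBound.comap {V W : Type*} {G : V → V → Prop} {k : ℕ} (h : CliqueBound G k)
    (f : W ↪ V) : CliqueBound (fun x y => G (f x) (f y)) k := by
  intro S hS
  rw [← Finset.card_map f]
  refine h _ ?_
  intro u hu v hv hxy
  obtain ⟨x, hx, rfl⟩ := Finset.mem_map.1 hu
  obtain ⟨y, hy, rfl⟩ := Finset.mem_map.1 hv
  exact hS hx hy (fun h => hxy (congrArg _ h))

/-- A clique projects to a clique of `G`, and each of its fibres is a clique of `H`. -/
lemma CliqueBound.lexProduct {V W : Type*} [DecidableEq V] {G : V → V → Prop}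
    {H : W → W → Prop} {k l : ℕ} (hG : CliqueBound G k) (hH : CliqueBound H l) :
    CliqueBound (lexProduct G H) (k * l) := by
  intro S hS
  have h1 : (S.image Prod.fst).card ≤ k := by
    refine hG _ ?_
    intro u hu v hv hxy
    obtain ⟨x, hx, rfl⟩ := Finset.mem_image.1 hu
    obtain ⟨y, hy, rfl⟩ := Finset.mem_image.1 hv
    have := hS hx hy (fun h => hxy (congrArg _ h))
    rwa [_root_.lexProduct, if_neg hxy] at this
  have h2 : ∀ v ∈ S.image Prod.fst, (S.filter fun x => x.1 = v).card ≤ l := by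
    intro v _
    have hinj : Set.InjOn Prod.snd (S.filter fun x => x.1 = v : Set (V × W)) := by
      rintro ⟨a, b⟩ hx ⟨c, d⟩ hy (rfl : b = d)
      simp only [Finset.coe_filter, Set.mem_ofPred_eq] at hx hy
      rw [hx.2, hy.2]
    classical
    rw [← Finset.card_image_of_injOn (f := Prod.snd) (by simpa using hinj)]
    refine hH _ ?_
    intro u hu v hv hxy
    obtain ⟨x, hx, rfl⟩ := Finset.mem_image.1 hu
    obtain ⟨y, hy, rfl⟩ := Finset.mem_image.1 hv
    rw [Finset.mem_filter] at hx hy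
    have := hS hx.1 hy.1 (fun h => hxy (congrArg _ h))
    rwa [_root_.lexProduct, if_pos (hx.2.trans hy.2.symm)] at this
  calc S.card ≤ l * (S.image Prod.fst).card := Finset.card_le_mul_card_image S l h2
    _ ≤ l * k := Nat.mul_le_mul_left l h1
    _ = k * l := mul_comm l k

lemma Flattenable.comap {V W : Type*} {G : V → V → Prop} (h : Flattenable G) (f : W ↪ V) :
    Flattenable (fun x y => G (f x) (f y)) := fun s hs =>
  let ⟨e, he, h'⟩ := h s hs
  ⟨e ∘ f, fun _ => he _, fun _ _ huv => h' _ _ (f.injective.ne huv)⟩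

/-- The affine map that sends the unit segment to the segment `p` and vertical vectors to
themselves. -/
def placeAt (p : (ℝ × ℝ) × (ℝ × ℝ)) (z : ℝ × ℝ) : ℝ × ℝ :=
  (p.1.1 + z.1 * (p.2.1 - p.1.1), p.1.2 + z.1 * (p.2.2 - p.1.2) + z.2)

@[fun_prop]
lemma continuous_placeAt (p : (ℝ × ℝ) × (ℝ × ℝ)) : Continuous (placeAt p) := by
  unfold placeAt; fun_prop

lemma placeAt_unitSegment (p : (ℝ × ℝ) × (ℝ × ℝ)) :
    (placeAt p unitSegment.1, placeAt p unitSegment.2) = p := by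
  simp [placeAt, unitSegment]

lemma orient_placeAt (p : (ℝ × ℝ) × (ℝ × ℝ)) (a b c : ℝ × ℝ) :
    orient (placeAt p a) (placeAt p b) (placeAt p c) = (p.2.1 - p.1.1) * orient a b c := by
  simp only [orient, placeAt]; ring

/-- All orientations are scaled by the same factor, which enters the sign conditions squared. -/
lemma Realizes.placeAt {adj : Prop} {p q r : (ℝ × ℝ) × (ℝ × ℝ)} (hp : p.1.1 < p.2.1)
    (h : Realizes adj q r) :
    Realizes adj (placeAt p q.1, placeAt p q.2) (placeAt p r.1, placeAt p r.2) := by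
  have hd : 0 < p.2.1 - p.1.1 := sub_pos.2 hp
  have h1 : ∀ x y : ℝ, (p.2.1 - p.1.1) * x * ((p.2.1 - p.1.1) * y) =
    (p.2.1 - p.1.1) ^ 2 * (x * y) := fun x y => by ring
  have h2 : ∀ x : ℝ, (p.2.1 - p.1.1) ^ 2 * x < 0 ↔ x < 0 := fun x =>
    ⟨fun h => neg_of_mul_neg_right h (sq_nonneg _), mul_neg_of_pos_of_neg (pow_pos hd 2)⟩
  simpa only [Realizes, StrictlyCross, StrictlySeparated, orient_placeAt, h1, h2,
    mul_pos_iff_of_pos_left (pow_pos hd 2)] using h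

lemma Flattenable.lexProduct {V W : Type*} [Finite V] [DecidableEq V] {G : V → V → Prop}
    {H : W → W → Prop} (hG : Flattenable G) (hH : Flattenable H) :
    Flattenable (lexProduct G H) := by
  intro s hs
  have hpos : ∀ᶠ p in 𝓝 unitSegment, p.1.1 < p.2.1 :=
    (isOpen_lt (by fun_prop) (by fun_prop)).mem_nhds (by simp [unitSegment])
  -- `s` must be a neighbourhood of each `e v`, not merely contain it, to leave room for a thin
  -- bundle around `e v`.
  obtain ⟨e, hes, he⟩ := hG _ ((eventually_eventually_nhds.2 hs).and hpos)
  let T : V → (ℝ × ℝ) × (ℝ × ℝ) → (ℝ × ℝ) × (ℝ × ℝ) := fun v q =>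
    (_root_.placeAt (e v) q.1, _root_.placeAt (e v) q.2)
  have hT : ∀ v, Tendsto (T v) (𝓝 unitSegment) (𝓝 (e v)) := fun v => by
    have : Continuous (T v) := by fun_prop
    simpa only [T, placeAt_unitSegment] using this.tendsto unitSegment
  have h1 : ∀ᶠ q in 𝓝 unitSegment, ∀ v, T v q ∈ s :=
    eventually_all.2 fun v => (hT v).eventually (hes v).1
  have h2 : ∀ᶠ q in 𝓝 unitSegment ×ˢ 𝓝 unitSegment, ∀ u v, u ≠ v →
      Realizes (G u v) (T u q.1) (T v q.2) := by
    simp only [eventually_all]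
    intro u v huv
    have := (isOpen_realizes (G u v)).mem_nhds (x := (e u, e v)) (he u v huv)
    rw [nhds_prod_eq] at this
    exact ((hT u).prodMap (hT v)).eventually this
  -- One neighbourhood of the unit segment serves for all bundles: segments taken from it and placed
  -- at `e u` and `e v` relate as `e u` and `e v` do.
  obtain ⟨t, ht, h2⟩ := (eventually_prod_self_iff
    (r := fun q q' => ∀ u v, u ≠ v → Realizes (G u v) (T u q) (T v q'))).1 h2
  obtain ⟨f, hf, hf'⟩ := hH _ (inter_mem h1 ht)
  refine ⟨fun x => T x.1 (f x.2), fun x => (hf x.2).1 x.1, ?_⟩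
  rintro ⟨u, a⟩ ⟨v, b⟩ hne
  rw [_root_.lexProduct]
  split_ifs with huv
  · obtain rfl : u = v := huv
    exact (hf' a b fun h => hne (h ▸ rfl)).placeAt (hes u).2
  · exact h2 (f a) (hf a).2 (f b) (hf b).2 u v huv

/-- There is a flattenable graph on `n` vertices with no clique on more than `k` and no
independent set of more than `l` vertices. -/
def HasFlattenable (n k l : ℕ) : Prop :=
  ∃ G : Fin n → Fin n → Prop,
    Flattenable G ∧ CliqueBound G k ∧ CliqueBound (fun u v => ¬ G u v) l

lemma HasFlattenable.mul {n k l n' k' l' : ℕ} (h : HasFlattenable n k l)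
    (h' : HasFlattenable n' k' l') : HasFlattenable (n * n') (k * k') (l * l') := by
  obtain ⟨G, hG, hk, hl⟩ := h
  obtain ⟨H, hH, hk', hl'⟩ := h'
  refine ⟨_, (hG.lexProduct hH).comap finProdFinEquiv.symm.toEmbedding,
    (hk.lexProduct hk').comap _, ?_⟩
  simp only [not_lexProduct]
  exact (hl.lexProduct hl').comap finProdFinEquiv.symm.toEmbedding

lemma hasFlattenable_one : HasFlattenable 1 1 1 := by
  refine ⟨fun _ _ => True, fun s hs => ⟨fun _ => unitSegment, fun _ => mem_of_mem_nhds hs,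
    fun u v huv => absurd (Subsingleton.elim u v) huv⟩, fun S _ => ?_, fun S _ => ?_⟩ <;>
  exact S.card_le_univ.trans (by simp)

lemma HasFlattenable.pow {n k l : ℕ} (h : HasFlattenable n k l) (m : ℕ) :
    HasFlattenable (n ^ m) (k ^ m) (l ^ m) := by
  induction m with
  | zero => simpa using hasFlattenable_one
  | succ m ih => simpa only [pow_succ] using ih.mul h

lemma HasFlattenable.exists_isKL {n k l : ℕ} (h : HasFlattenable n k l) :
    ∃ M : SegmentArrangement n, M.IsKL k l := by
  obtain ⟨G, hG, hk, hl⟩ := h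
  obtain ⟨e, -, he⟩ := hG Set.univ univ_mem
  obtain ⟨M, hM⟩ := exists_segmentArrangement G e he
  refine ⟨M, fun S hS => hk S ?_, fun S hS => hl S ?_⟩
  · intro i hi j hj hij
    by_contra hn
    exact Set.not_disjoint_iff_nonempty_inter.2 (hS hi hj hij) ((hM i j hij).2 hn)
  · intro i hi j hj hij hn
    exact Set.not_disjoint_iff_nonempty_inter.2 ((hM i j hij).1 hn) (hS hi hj hij)

/-! ### Signs of integer polynomials at small positive arguments -/

/-- Integer polynomials in one variable as lists of coefficients, constant term first. -/
abbrev CoeffList : Type := List ℤ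

namespace CoeffList

/-- The value of a polynomial at a real number. -/
def eval (t : ℝ) : CoeffList → ℝ
  | [] => 0
  | a :: p => a + t * eval t p

/-- The sum of two polynomials. -/
def add : CoeffList → CoeffList → CoeffList
  | [], q => q
  | p, [] => p
  | a :: p, b :: q => (a + b) :: add p q

/-- An integer multiple of a polynomial. -/
def scale (c : ℤ) : CoeffList → CoeffList
  | [] => []
  | a :: p => (c * a) :: scale c p

/-- The difference of two polynomials. -/
def sub (p q : CoeffList) : CoeffList := add p (scale (-1) q)

/-- The product of two polynomials. -/
def mul : CoeffList → CoeffList → CoeffList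
  | [], _ => []
  | a :: p, q => add (scale a q) (0 :: mul p q)

/-- The lowest nonzero coefficient of a polynomial (zero if there is none). -/
def lowest : CoeffList → ℤ
  | [] => 0
  | a :: p => if a = 0 then lowest p else a

lemma eval_add (t : ℝ) (p q : CoeffList) : eval t (add p q) = eval t p + eval t q := by
  induction p, q using add.induct with
  | case1 q => simp [add, eval]
  | case2 p h => cases p <;> simp [add, eval]
  | case3 a p b q ih => simp only [add, eval, ih]; push_cast; ring

lemma eval_scale (t : ℝ) (c : ℤ) (p : CoeffList) : eval t (scale c p) = c * eval t p := by
  induction p with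
  | nil => simp [scale, eval]
  | cons a p ih => simp only [scale, eval, ih]; push_cast; ring

lemma eval_sub (t : ℝ) (p q : CoeffList) : eval t (sub p q) = eval t p - eval t q := by
  rw [sub, eval_add, eval_scale]; push_cast; ring

lemma eval_mul (t : ℝ) (p q : CoeffList) : eval t (mul p q) = eval t p * eval t q := by
  induction p with
  | nil => simp [mul, eval]
  | cons a p ih => simp only [mul, eval, eval_add, eval_scale, ih]; push_cast; ring

lemma continuous_eval (p : CoeffList) : Continuous fun t => eval t p := by
  induction p with
  | nil => exact continuous_const
  | cons a p ih => simp only [eval]; fun_prop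

lemma eventually_eval_pos {p : CoeffList} (h : 0 < lowest p) :
    ∀ᶠ t in 𝓝[>] (0 : ℝ), 0 < eval t p := by
  induction p with
  | nil => simp [lowest] at h
  | cons a p ih =>
    by_cases ha : a = 0
    · rw [lowest, if_pos ha] at h
      filter_upwards [ih h, self_mem_nhdsWithin] with t h1 (ht : 0 < t)
      rw [eval, ha, Int.cast_zero, zero_add]
      exact mul_pos ht h1
    · rw [lowest, if_neg ha] at h
      refine Filter.Eventually.filter_mono nhdsWithin_le_nhds ?_
      refine (isOpen_lt continuous_const (continuous_eval (a :: p))).mem_nhds ?_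
      simpa [eval] using h

lemma eventually_eval_neg {p : CoeffList} (h : lowest p < 0) :
    ∀ᶠ t in 𝓝[>] (0 : ℝ), eval t p < 0 := by
  have hs : ∀ q : CoeffList, lowest (scale (-1) q) = -lowest q := fun q => by
    induction q with
    | nil => rfl
    | cons a q ih => by_cases ha : a = 0 <;> simp [scale, lowest, ha, ih]
  filter_upwards [eventually_eval_pos (p := scale (-1) p) (by rw [hs]; omega)] with t ht
  rw [eval_scale] at ht
  push_cast at ht
  linarith

/-- The orientation of three points whose coordinates are polynomials. -/
def orient (a b c : CoeffList × CoeffList) : CoeffList :=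
  sub (mul (sub b.1 a.1) (sub c.2 a.2)) (mul (sub b.2 a.2) (sub c.1 a.1))

/-- The position at time `t` of a point whose coordinates are polynomials. -/
def evalPoint (t : ℝ) (a : CoeffList × CoeffList) : ℝ × ℝ := (eval t a.1, eval t a.2)

lemma eval_orient (t : ℝ) (a b c : CoeffList × CoeffList) :
    eval t (orient a b c) = _root_.orient (evalPoint t a) (evalPoint t b) (evalPoint t c) := by
  simp only [orient, eval_sub, eval_mul, _root_.orient, evalPoint]

/-- A sufficient condition on lowest coefficients for `Realizes` to hold at all small positive
times. -/
def realizes (adj : Bool) (p q : (CoeffList × CoeffList) × (CoeffList × CoeffList)) : Bool :=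
  let x := lowest (mul (orient p.1 p.2 q.1) (orient p.1 p.2 q.2))
  let y := lowest (mul (orient q.1 q.2 p.1) (orient q.1 q.2 p.2))
  if adj then x < 0 && y < 0 else 0 < x || 0 < y

lemma eventually_realizes {adj : Bool} {p q : (CoeffList × CoeffList) × (CoeffList × CoeffList)}
    (h : realizes adj p q) : ∀ᶠ t in 𝓝[>] (0 : ℝ),
      Realizes (adj = true) (evalPoint t p.1, evalPoint t p.2)
        (evalPoint t q.1, evalPoint t q.2) := by
  cases adj
  · simp only [realizes, Bool.false_eq_true, if_false, Bool.or_eq_true, decide_eq_true_eq] at h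
    rcases h with h | h <;>
    · filter_upwards [eventually_eval_pos h] with t ht
      rw [eval_mul, eval_orient, eval_orient] at ht
      simp [Realizes, StrictlySeparated, ht]
  · simp only [realizes, if_true, Bool.and_eq_true, decide_eq_true_eq] at h
    filter_upwards [eventually_eval_neg h.1, eventually_eval_neg h.2] with t h1 h2
    rw [eval_mul, eval_orient, eval_orient] at h1 h2
    simp [Realizes, StrictlyCross, h1, h2]

end CoeffList

/-! ### The circulant graph and its complement -/

/-- A segment depending on a small parameter `t`: it joins `(x t, a t + b t ^ 4)` to
`(1 - x' t, a' t + c t ^ 3 + d t ^ 4)`. -/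
def movingSegment (x a b x' a' c d : ℤ) : (CoeffList × CoeffList) × (CoeffList × CoeffList) :=
  (([0, x], [0, a, 0, 0, b]), ([1, -x'], [0, a', 0, c, d]))

/-- A graph that is realized by moving segments for small times is flattenable. -/
lemma flattenable_of_movingSegment {n : ℕ} (adj : Fin n → Fin n → Bool)
    (x a b x' a' c d : Fin n → ℤ)
    (h : ∀ i j, i ≠ j → CoeffList.realizes (adj i j)
      (movingSegment (x i) (a i) (b i) (x' i) (a' i) (c i) (d i))
      (movingSegment (x j) (a j) (b j) (x' j) (a' j) (c j) (d j))) :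
    Flattenable fun i j => adj i j = true := by
  intro s hs
  let e : ℝ → Fin n → (ℝ × ℝ) × (ℝ × ℝ) := fun t i =>
    let p := movingSegment (x i) (a i) (b i) (x' i) (a' i) (c i) (d i)
    (CoeffList.evalPoint t p.1, CoeffList.evalPoint t p.2)
  have h1 : ∀ᶠ t in 𝓝[>] (0 : ℝ), ∀ i, e t i ∈ s := by
    refine eventually_all.2 fun i => Filter.Eventually.filter_mono nhdsWithin_le_nhds ?_
    have hc : Continuous fun t => e t i :=
      (((CoeffList.continuous_eval _).prodMk (CoeffList.continuous_eval _)).prodMk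
        ((CoeffList.continuous_eval _).prodMk (CoeffList.continuous_eval _)))
    have h0 : e 0 i = unitSegment := by
      simp [e, movingSegment, CoeffList.evalPoint, CoeffList.eval, unitSegment]
    exact (hc.tendsto' 0 _ h0).eventually hs
  have h2 : ∀ᶠ t in 𝓝[>] (0 : ℝ), ∀ i j, i ≠ j → Realizes (adj i j = true) (e t i) (e t j) := by
    simp only [eventually_all]
    exact fun i j hij => CoeffList.eventually_realizes (h i j hij)
  obtain ⟨t, h1, h2⟩ := (h1.and h2).exists
  exact ⟨e t, h1, h2⟩

/-- The circulant graph on `ℤ / 13` with distances `1` and `5`, which has neither triangles nor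
independent sets of size `5`. -/
def circulant (i j : Fin 13) : Bool := i - j == 1 || i - j == 5 || i - j == 8 || i - j == 12

lemma cliqueBound_circulant : CliqueBound (fun i j => circulant i j = true) 2 := by
  intro S hS
  by_contra! h
  obtain ⟨a, ha, b, hb, c, hc, hab, hac, hbc⟩ := Finset.two_lt_card.1 h
  -- Hypotheses interleaved with the quantifiers prune the exhaustive search.
  have key : ∀ a b, circulant a b = true → ∀ c, circulant a c = true →
      ¬ circulant b c = true := by decide +kernel
  exact key a b (hS ha hb hab) c (hS ha hc hac) (hS hb hc hbc)

/-- `i < j`, and `i` and `j` are not adjacent in the circulant graph. -/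
def nonadjacentLt (i j : Fin 13) : Bool := decide (i < j) && !circulant i j

lemma cliqueBound_not_circulant : CliqueBound (fun i j => ¬ circulant i j = true) 4 := by
  intro S hS
  by_contra! h
  obtain ⟨T, hTS, hT⟩ := Finset.exists_subset_card_eq h
  have hf : ∀ i j, i < j → nonadjacentLt (T.orderEmbOfFin hT i) (T.orderEmbOfFin hT j) = true := by
    intro i j hij
    have hlt := (T.orderEmbOfFin hT).strictMono hij
    have := hS (hTS (T.orderEmbOfFin_mem hT i)) (hTS (T.orderEmbOfFin_mem hT j)) hlt.ne
    simpa [nonadjacentLt, hlt] using this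
  generalize T.orderEmbOfFin hT = f at hf
  have key : ∀ a b, nonadjacentLt a b = true → ∀ c, (nonadjacentLt a c && nonadjacentLt b c) = true →
      ∀ d, (nonadjacentLt a d && nonadjacentLt b d && nonadjacentLt c d) = true →
      ∀ e, (nonadjacentLt a e && nonadjacentLt b e && nonadjacentLt c e && nonadjacentLt d e)
        = false := by decide +kernel
  have := key (f 0) (f 1) (hf 0 1 (by decide)) (f 2) (by simp [hf]) (f 3) (by simp [hf]) (f 4)
  simp [hf] at this

lemma flattenable_circulant : Flattenable fun i j => circulant i j = true := by
  refine flattenable_of_movingSegment circulant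
    -- The rows are `x`, `a`, `b`, `x'`, `a'`, `c`, `d` of `movingSegment`, with one column per
    -- vertex.
    ![4, 4, -2, -2, 1, 0, -2, 3, 1, 0, -2, -1, 0]
    ![0, 0, 0, 0, 0, -2, 0, 0, 0, -1, 0, 0, 1]
    ![-1, 15, -2, 7, -1, 0, 8, -1, 0, 0, 4, 0, 0]
    ![1, 8, 9, 11, 3, 6, 5, 0, 7, 10, 2, 0, 4]
    ![0, 0, 0, 0, 0, 0, 0, 1, 0, 0, 0, 2, 0]
    ![1, 0, 1, -2, -2, 1, 1, 0, 0, 1, -2, 0, -2]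
    ![1, 10, -5, 29, 15, 5, 0, 0, 8, -9, 7, 0, 14] ?_
  decide +kernel

lemma flattenable_not_circulant : Flattenable fun i j => ¬ circulant i j = true := by
  have h :=  flattenable_of_movingSegment (fun i j => !circulant i j)
    ![2, 3, -5, -4, 0, 3, -1, 0, -5, -4, 1, 0, -4]
    ![0, 0, 0, 0, 1, 0, 0, 0, 0, 0, 0, 2, 0]
    ![-38, 5, -53, -43, 0, 36, 1, 1, -46, -44, 8, 0, -39]
    ![0, 5, 4, 11, 7, 8, 3, 1, 2, 9, 6, 10, 12]
    ![1, 0, 0, 0, 0, 0, 0, 0, 0, 0, 0, 0, 0]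
    ![0, 0, 11, 1, -2, 0, -1, 1, 1, 11, -1, -1, 0]
    ![0, 4, -42, 1, 23, 1, 9, 6, 1, -91, 11, 20, 11] (by decide +kernel)
  simpa using h

lemma hasFlattenable_base : HasFlattenable 169 8 8 := by
  have h1 : HasFlattenable 13 2 4 :=
    ⟨_, flattenable_circulant, cliqueBound_circulant, cliqueBound_not_circulant⟩
  have h2 : HasFlattenable 13 4 2 :=
    ⟨_, flattenable_not_circulant, cliqueBound_not_circulant,
      by simpa only [not_not] using cliqueBound_circulant⟩
  exact h1.mul h2

/-! ### The exponent and the conclusion -/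

lemma pow_rpow_log_div_log (m : ℕ) :
    ((169 ^ m : ℕ) : ℝ) = ((8 ^ m : ℕ) : ℝ) ^ (Real.log 169 / Real.log 8) := by
  have h8 : (8 : ℝ) ^ (Real.log 169 / Real.log 8) = 169 := by
    have := Real.rpow_logb (b := 8) (x := 169) (by norm_num) (by norm_num) (by norm_num)
    rwa [Real.logb] at this
  push_cast
  rw [← Real.rpow_natCast 8 m, ← Real.rpow_mul (by norm_num), mul_comm,
    Real.rpow_mul (by norm_num), h8, Real.rpow_natCast]

set_option exponentiation.threshold 600 in
lemma lt_log_div_log : (2.4669 : ℝ) < Real.log 169 / Real.log 8 := by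
  have h8 : 0 < Real.log 8 := Real.log_pos (by norm_num)
  -- The fraction `597 / 242` lies between `2.4669` and `log 169 / log 8`.
  have h : (597 : ℝ) * Real.log 8 < 242 * Real.log 169 := by
    have := Real.log_lt_log (x := (8 : ℝ) ^ 597) (y := (169 : ℝ) ^ 242) (by positivity)
      (by norm_num)
    rw [Real.log_pow, Real.log_pow] at this
    exact_mod_cast this
  rw [lt_div_iff₀ h8]
  linarith

theorem theorem1 :
    {k : ℕ | 0 < k ∧
      (∃ n : ℕ, (n : ℝ) = (k : ℝ) ^ (Real.log 169 / Real.log 8) ∧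
        ∃ M : SegmentArrangement n, M.IsKL k k) ∧
      (k : ℝ) ^ (2.4669 : ℝ) < (k : ℝ) ^ (Real.log 169 / Real.log 8) ∧
      ENNReal.ofReal ((k : ℝ) ^ (Real.log 169 / Real.log 8)) ≤
        ((ramseySegments k : ℕ∞) : ℝ≥0∞)}.Infinite := by
  -- The exponent `m + 1` excludes `k = 1`, where the strict inequality between powers fails.
  refine Set.infinite_of_injective_forall_mem (f := fun m : ℕ => 8 ^ (m + 1))
    ((Nat.pow_right_injective (by norm_num)).comp (add_left_injective 1)) fun m => ?_
  obtain ⟨M, hM⟩ := (hasFlattenable_base.pow (m + 1)).exists_isKL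
  refine ⟨by positivity, ⟨169 ^ (m + 1), pow_rpow_log_div_log _, M, hM⟩, ?_, ?_⟩
  · refine Real.rpow_lt_rpow_of_exponent_lt ?_ lt_log_div_log
    exact_mod_cast Nat.one_lt_pow (Nat.succ_ne_zero m) (by norm_num)
  · rw [← pow_rpow_log_div_log, ENNReal.ofReal_natCast, ← ENat.toENNReal_coe]
    exact ENat.toENNReal_le.2 (le_sSup ⟨_, rfl, M, hM⟩)
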